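/- For $H\in(0,1)$ and $v\in\mathbb{R}$ let $$F_H(v)=e^{Hv}+e^{-Hv}-\left|e^{v/2}-e^{-v/2}\right|^{2H}.$$ Let $0<H_1<1$ and $0<H_2<1$. For $\mathbf v=(v_1,v_2)\in\mathbb{R}^2$ put $R_0(\mathbf v)=\frac14F_{H_1}(v_1)F_{H_2}(v_2)$ and, for $\theta\in\mathbb{R}$, let $R_\theta:\mathbb{R}^2\to\mathbb{R}$ be $$R_\theta(\mathbf v)=\tfrac14F_{H_1}(v_1)F_{H_2}(v_2)\left(1+\theta e^{-H_1|v_1|-H_2|v_2|}\sinh(H_1v_1)\sinh(H_2v_2)\right).$$ Then: (i) for every $\theta\in\mathbb{R}$ and every $\mathbf v\in\mathbb{R}^2$, $R_\theta(\mathbf v)=R_\theta(-\mathbf v)$; (ii) for every $\theta\neq0$, $R_\theta$ does not coincide identically with $R_0$; (iii) for every $\theta\in\mathbb{R}$ and every $\mathbf v\in\mathbb{R}^2$, $R_\theta(\mathbf v)+R_\theta(v_1,-v_2)=R_\theta(\mathbf v)+R_\theta(-v_1,v_2)=2R_0(\mathbf v)$; (iv) there exists $\theta\neq0$ (which may depend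 on $H_1,H_2$) such that $(\mathbf u,\mathbf v)\mapsto R_\theta(\mathbf u-\mathbf v)$ is positive definite, i.e. it is symmetric and $\sum_{i,j=1}^n c_ic_jR_\theta(\mathbf u_i-\mathbf u_j)\ge0$ for all $n\in\mathbb{N}$, $\mathbf u_1,\dots,\mathbf u_n\in\mathbb{R}^2$ and $c_1,\dots,c_n\in\mathbb{R}$. -/

import Mathlib

noncomputable section

/-- `F_H(v) = e^{Hv} + e^{-Hv} - |e^{v/2} - e^{-v/2}|^{2H}`. -/
def covF (H v : ℝ) : ℝ :=
  Real.exp (H * v) + Real.exp (-(H * v)) - |Real.exp (v / 2) - Real.exp (-(v / 2))| ^ (2 * H)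

/-- `R₀(v) = (1/4) F_{H₁}(v₁) F_{H₂}(v₂)`, the covariance function of the stationary field
associated with the fractional Brownian sheet. -/
def covR0 (H₁ H₂ : ℝ) (v : ℝ × ℝ) : ℝ :=
  1 / 4 * covF H₁ v.1 * covF H₂ v.2

/-- `R_θ(v) = (1/4) F_{H₁}(v₁) F_{H₂}(v₂) (1 + θ e^{-H₁|v₁| - H₂|v₂|} sinh(H₁v₁) sinh(H₂v₂))`. -/
def covR (H₁ H₂ θ : ℝ) (v : ℝ × ℝ) : ℝ :=
  1 / 4 * covF H₁ v.1 * covF H₂ v.2 *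
    (1 + θ * Real.exp (-H₁ * |v.1| - H₂ * |v.2|) * Real.sinh (H₁ * v.1) * Real.sinh (H₂ * v.2))

/-- A real kernel on an arbitrary (possibly infinite) set is positive definite, in the sense used
for covariance functions, if it is symmetric and `∑ᵢ ∑ⱼ cᵢ cⱼ K(xᵢ, xⱼ) ≥ 0` for all finite
families of points and real coefficients. `Matrix.PosSemidef` for an arbitrary index type
quantifies over exactly the finitely supported coefficient families. -/
def IsPositiveDefiniteKernel {X : Type*} (K : X → X → ℝ) : Prop :=
  (Matrix.of K).PosSemidef

end

open Filter Topology MeasureTheory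
open scoped ComplexOrder FourierTransform Matrix

/-!
Put `G_H(v) = F_H(v) e ^ (-H|v|) sinh (H v)`, an odd function. Then
`4 R_θ(v) = F_{H₁}(v₁) F_{H₂}(v₂) + θ G_{H₁}(v₁) G_{H₂}(v₂)`, so the symmetries of `R_θ` follow from
the parities of `F` and `G`, and only positive definiteness for some `θ ≠ 0` needs an argument.

**Reduction to one variable.** Suppose that, for `H = H₁` and `H = H₂`, the Hermitian kernel of
`C F_H + i G_H` is positive definite for some `C > 0`. The Schur product of `C₁ F_{H₁} + i G_{H₁}`
and of the transposed kernel `C₂ F_{H₂} - i G_{H₂}` is positive definite, and so is its real part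
`C₁ C₂ F_{H₁} F_{H₂} + G_{H₁} G_{H₂}`; hence `θ = 1 / (C₁ C₂)` works.

**One variable** (`exists_isPosDefFun_covF_add_covG`). The claim is that the Fourier transform of
`F_H` dominates that of `G_H`. Let `x = e ^ (-|v|)` and `1 - (1 - x) ^ (2H) = ∑ a_n x ^ (n + 1)`.
Then `F_H(v) = e ^ (-H|v|) + ∑ a_n e ^ (-(n + 1 - H)|v|)` (`hasSum_covF`). Since
`e ^ (-H|v|) sinh (H v) = sgn v (1 - e ^ (-2H|v|)) / 2`, the function `G_H` is the corresponding
series of `sgn v (e ^ (-a|v|) - e ^ (-b|v|)) / 2` with `b = a + 2H` (`hasSum_covG`). All these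
functions have explicit rational spectral densities.

* If `H ≤ 1 / 2`, then `a_n ≥ 0` and each term of `F_H` dominates the corresponding term of `G_H`.
* If `1 / 2 < H`, then `a_n ≤ 0` for `n ≥ 1`. The identities `∑ a_n = 1` and `∑ (n + 1) a_n = 0`
  allow the series of `F_H` to be regrouped into terms with nonnegative densities
  (`hasSpectralDensity_covF`). Their sum decays no faster than `|w| ^ (-3)`
  (`exists_le_tsum_covFDensity`), while the terms of `G_H` have densities of order `|w| ^ (-3)` with
  summable constants.
-/

/-! ### The binomial series of `1 - (1 - x) ^ α` on `[0, 1]` -/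

/-- The coefficient of `x ^ n` in the power series of `(1 - x) ^ (α - 1)`, written as a product. -/
noncomputable def binomProd (α : ℝ) (n : ℕ) : ℝ :=
  ∏ i ∈ Finset.range n, (1 - α / (i + 1))

/-- The coefficient of `x ^ (n + 1)` in the power series of `1 - (1 - x) ^ α`. -/
noncomputable def binomCoeff (α : ℝ) (n : ℕ) : ℝ :=
  α / (n + 1) * binomProd α n

@[simp] lemma binomProd_zero (α : ℝ) : binomProd α 0 = 1 := by simp [binomProd]

lemma binomProd_succ (α : ℝ) (n : ℕ) :
    binomProd α (n + 1) = binomProd α n * (1 - α / (n + 1)) := by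
  simp [binomProd, Finset.prod_range_succ]

lemma binomCoeff_eq_sub (α : ℝ) (n : ℕ) :
    binomCoeff α n = binomProd α n - binomProd α (n + 1) := by
  rw [binomProd_succ, binomCoeff]; ring

lemma binomProd_add_one_succ (α : ℝ) (n : ℕ) :
    binomProd (α + 1) (n + 1) = -binomCoeff α n := by
  induction n with
  | zero => simp [binomCoeff, binomProd_succ]
  | succ n ih =>
    rw [binomProd_succ, ih, binomCoeff, binomCoeff, binomProd_succ]
    push_cast
    field_simp
    ring

lemma sum_binomCoeff (α : ℝ) (n : ℕ) :
    ∑ i ∈ Finset.range n, binomCoeff α i = 1 - binomProd α n := by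
  simp_rw [binomCoeff_eq_sub]
  rw [Finset.sum_range_sub', binomProd_zero]

/-- The product defining `binomProd α` diverges to `0`, since the harmonic series diverges. -/
lemma tendsto_binomProd {α : ℝ} (h0 : 0 < α) (h2 : α < 2) :
    Tendsto (binomProd α) atTop (𝓝 0) := by
  have key : ∀ n : ℕ, |binomProd α (n + 1)| ≤
      Real.exp α * Real.exp (-(α * ∑ i ∈ Finset.range (n + 1), 1 / ((i : ℝ) + 1))) := by
    intro n
    induction n with
    | zero =>
      rw [← Real.exp_add]
      simp [binomProd_succ, abs_le]
      constructor <;> linarith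
    | succ n ih =>
      rw [binomProd_succ, abs_mul, Finset.sum_range_succ, mul_add, neg_add, Real.exp_add,
        ← mul_assoc]
      refine mul_le_mul ih ?_ (abs_nonneg _) (by positivity)
      have hn : α / ((n + 1 : ℕ) + 1 : ℝ) ≤ 1 := by
        rw [div_le_one (by positivity)]
        push_cast
        linarith [(Nat.cast_nonneg n : (0 : ℝ) ≤ n)]
      rw [abs_of_nonneg (by linarith), mul_one_div]
      linarith [Real.add_one_le_exp (-(α / ((n + 1 : ℕ) + 1 : ℝ)))]
  rw [← tendsto_add_atTop_iff_nat 1]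
  refine squeeze_zero_norm key ?_
  rw [← mul_zero (Real.exp α)]
  refine Tendsto.const_mul _ (Real.tendsto_exp_neg_atTop_nhds_zero.comp ?_)
  exact (Real.tendsto_sum_range_one_div_nat_succ_atTop.comp
    (tendsto_add_atTop_nat 1)).const_mul_atTop h0

lemma binomProd_nonneg {α : ℝ} (h1 : α ≤ 1) (n : ℕ) : 0 ≤ binomProd α n := by
  refine Finset.prod_nonneg fun i _ => ?_
  have : α / ((i : ℝ) + 1) ≤ 1 := by
    rw [div_le_one (by positivity)]
    linarith [(Nat.cast_nonneg i : (0 : ℝ) ≤ i)]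
  linarith

lemma binomCoeff_nonneg {α : ℝ} (h0 : 0 ≤ α) (h1 : α ≤ 1) (n : ℕ) : 0 ≤ binomCoeff α n :=
  mul_nonneg (by positivity) (binomProd_nonneg h1 n)

lemma hasSum_binomCoeff_of_le_one {α : ℝ} (h0 : 0 < α) (h1 : α ≤ 1) :
    HasSum (binomCoeff α) 1 := by
  rw [hasSum_iff_tendsto_nat_of_nonneg (binomCoeff_nonneg h0.le h1)]
  simp_rw [sum_binomCoeff]
  simpa using (tendsto_binomProd h0 (by linarith)).const_sub 1

/-- For `1 < α < 2` the coefficients of `(1 - x) ^ (α - 1)` are summable with sum `0`, the value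
of that function at `x = 1`. -/
lemma hasSum_binomProd {α : ℝ} (h1 : 1 < α) (h2 : α < 2) : HasSum (binomProd α) 0 := by
  rw [← hasSum_nat_add_iff' 1]
  have h := (hasSum_binomCoeff_of_le_one (α := α - 1) (by linarith) (by linarith)).neg
  simpa [← binomProd_add_one_succ] using h

lemma add_one_mul_binomCoeff (α : ℝ) (n : ℕ) :
    ((n : ℝ) + 1) * binomCoeff α n = α * binomProd α n := by
  rw [binomCoeff]; field_simp

lemma summable_add_one_mul_abs_binomCoeff {α : ℝ} (h1 : 1 < α) (h2 : α < 2) :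
    Summable fun n : ℕ => ((n : ℝ) + 1) * |binomCoeff α n| := by
  have h := ((hasSum_binomProd h1 h2).summable.abs).mul_left α
  refine h.congr fun n => ?_
  rw [← abs_of_pos (show (0 : ℝ) < n + 1 by positivity), ← abs_mul,
    add_one_mul_binomCoeff, abs_mul,
    abs_of_pos (by linarith : 0 < α)]

lemma hasSum_binomCoeff {α : ℝ} (h0 : 0 < α) (h2 : α < 2) : HasSum (binomCoeff α) 1 := by
  rcases le_or_gt α 1 with h1 | h1
  · exact hasSum_binomCoeff_of_le_one h0 h1
  · have hs : Summable (binomCoeff α) := by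
      refine .of_norm_bounded (summable_add_one_mul_abs_binomCoeff h1 h2) fun n => ?_
      rw [Real.norm_eq_abs]
      nlinarith [abs_nonneg (binomCoeff α n), (Nat.cast_nonneg n : (0 : ℝ) ≤ n)]
    have ht := hs.hasSum.tendsto_sum_nat
    simp_rw [sum_binomCoeff] at ht
    have : Tendsto (fun n => 1 - binomProd α n) atTop (𝓝 1) := by
      simpa using (tendsto_binomProd h0 h2).const_sub 1
    rw [← tendsto_nhds_unique ht this]
    exact hs.hasSum

lemma choose_mul_neg_one_pow (α : ℝ) (n : ℕ) :
    Ring.choose α n * (-1) ^ n = binomProd (α + 1) n := by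
  induction n with
  | zero => simp
  | succ n ih =>
    have h1 := Ring.descPochhammer_eq_factorial_smul_choose α n
    have h2 := Ring.descPochhammer_eq_factorial_smul_choose α (n + 1)
    rw [descPochhammer_succ_right, Polynomial.smeval_mul, h1] at h2
    simp [Nat.factorial_succ, Polynomial.smeval_natCast] at h2
    have hf : (n.factorial : ℝ) ≠ 0 := by positivity
    have h3 : Ring.choose α n * (α - n) = (n + 1) * Ring.choose α (n + 1) := by
      apply mul_left_cancel₀ hf
      linear_combination h2
    have h4 : Ring.choose α (n + 1) = Ring.choose α n * (α - n) / (n + 1) := by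
      rw [h3]; field_simp
    rw [h4, binomProd_succ, ← ih, pow_succ]
    field_simp
    ring

/-- The binomial series of `1 - (1 - x) ^ α`, up to and including the endpoint `x = 1`. -/
lemma hasSum_binomCoeff_mul_pow {α x : ℝ} (h0 : 0 < α) (h2 : α < 2) (hx0 : 0 ≤ x) (hx1 : x ≤ 1) :
    HasSum (fun n : ℕ => binomCoeff α n * x ^ (n + 1)) (1 - (1 - x) ^ α) := by
  rcases hx1.lt_or_eq with hx | rfl
  · have h := (Real.one_add_rpow_hasFPowerSeriesOnBall_zero (a := α)).hasSum (y := -x)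
      (by simp [abs_of_nonneg hx0, hx, enorm_eq_nnnorm, ← NNReal.coe_lt_coe])
    have h' : HasSum (fun n : ℕ => binomProd (α + 1) n * x ^ n) ((1 - x) ^ α) := by
      convert! h using 1
      · ext n
        rw [binomialSeries_apply, ← choose_mul_neg_one_pow, List.ofFn_const, List.prod_replicate,
          neg_pow x n, smul_eq_mul, mul_assoc]
      · simp [sub_eq_add_neg]
    rw [← hasSum_nat_add_iff' 1] at h'
    convert! h'.neg using 1
    · ext n; simp [binomProd_add_one_succ]
    · simp
  · simpa [Real.zero_rpow h0.ne'] using hasSum_binomCoeff h0 h2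

/-! ### Positive definite functions and spectral densities -/

/-- The translation invariant kernel `(u, v) ↦ φ (u - v)` on the line is positive definite
(in the complex, hence Hermitian, sense). -/
def IsPosDefFun (φ : ℝ → ℂ) : Prop :=
  (Matrix.of fun u v : ℝ => φ (u - v)).PosSemidef

/-- `φ` is the inverse Fourier transform of the integrable real function `f`, with the
normalisation `φ v = ∫ e ^ (2πiξv) f ξ dξ`. No sign condition is put on `f`. -/
def HasSpectralDensity (φ : ℝ → ℂ) (f : ℝ → ℝ) : Prop :=
  Integrable f ∧ ∀ v, φ v = ∫ ξ, Complex.exp ((2 * Real.pi * ξ * v : ℝ) * Complex.I) * (f ξ : ℂ)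

namespace IsPosDefFun

lemma smul {φ : ℝ → ℂ} (h : IsPosDefFun φ) {c : ℝ} (hc : 0 ≤ c) :
    IsPosDefFun fun v => (c : ℂ) * φ v := by
  have := Matrix.PosSemidef.smul (α := ℂ) h (a := (c : ℂ)) (by exact_mod_cast hc)
  exact this

lemma add {φ ψ : ℝ → ℂ} (hφ : IsPosDefFun φ) (hψ : IsPosDefFun ψ) :
    IsPosDefFun fun v => φ v + ψ v :=
  Matrix.PosSemidef.add hφ hψ

lemma of_tendsto {φ : ℕ → ℝ → ℂ} {ψ : ℝ → ℂ} (h : ∀ n, IsPosDefFun (φ n))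
    (hlim : ∀ v, Tendsto (fun n => φ n v) atTop (𝓝 (ψ v))) : IsPosDefFun ψ := by
  refine ⟨?_, fun x => ?_⟩
  · ext u v
    have h1 : Tendsto (fun n => star (φ n (v - u))) atTop (𝓝 (star (ψ (v - u)))) :=
      (continuous_star.tendsto _).comp (hlim _)
    refine tendsto_nhds_unique h1 ((hlim (u - v)).congr fun n => ?_)
    exact (congrFun (congrFun (h n).1 u) v).symm
  · refine ge_of_tendsto' (f := fun n => x.sum fun i xi => x.sum fun j xj =>
      star xi * φ n (i - j) * xj) (x := atTop) ?_ fun n => (h n).2 x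
    simp only [Finsupp.sum]
    exact tendsto_finsetSum _ fun i _ => tendsto_finsetSum _ fun j _ =>
      ((hlim _).const_mul _).mul_const _

lemma of_hasSum {φ : ℕ → ℝ → ℂ} {ψ : ℝ → ℂ} (h : ∀ n, IsPosDefFun (φ n))
    (hsum : ∀ v, HasSum (fun n => φ n v) (ψ v)) : IsPosDefFun ψ := by
  refine of_tendsto (φ := fun n v => ∑ i ∈ Finset.range n, φ i v) (fun n => ?_)
    fun v => (hsum v).tendsto_sum_nat
  have := Matrix.posSemidef_sum (Finset.range n) (fun i _ => h i)
  have heq : (∑ i ∈ Finset.range n, Matrix.of fun u v : ℝ => φ i (u - v)) =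
      Matrix.of fun u v : ℝ => ∑ i ∈ Finset.range n, φ i (u - v) := by
    ext u v
    simp [Matrix.sum_apply]
  rwa [heq] at this

end IsPosDefFun

namespace HasSpectralDensity

lemma integrable_char_mul {f : ℝ → ℝ} (hf : Integrable f) (v : ℝ) :
    Integrable fun ξ => Complex.exp ((2 * Real.pi * ξ * v : ℝ) * Complex.I) * (f ξ : ℂ) := by
  refine hf.ofReal.bdd_mul (c := 1) (by fun_prop) (ae_of_all _ fun ξ => ?_)
  rw [Complex.norm_exp_ofReal_mul_I]

lemma add {φ ψ : ℝ → ℂ} {f g : ℝ → ℝ} (hf : HasSpectralDensity φ f) (hg : HasSpectralDensity ψ g) :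
    HasSpectralDensity (fun v => φ v + ψ v) (fun ξ => f ξ + g ξ) := by
  refine ⟨hf.1.add hg.1, fun v => ?_⟩
  simp only
  rw [hf.2, hg.2, ← integral_add (integrable_char_mul hf.1 v) (integrable_char_mul hg.1 v)]
  simp [mul_add]

lemma smul {φ : ℝ → ℂ} {f : ℝ → ℝ} (hf : HasSpectralDensity φ f) (c : ℝ) :
    HasSpectralDensity (fun v => (c : ℂ) * φ v) (fun ξ => c * f ξ) := by
  refine ⟨hf.1.const_mul c, fun v => ?_⟩
  simp only
  rw [hf.2, ← integral_const_mul]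
  congr 1; ext ξ
  push_cast; ring

/-- The easy half of Bochner's theorem. -/
lemma isPosDefFun {φ : ℝ → ℂ} {f : ℝ → ℝ} (h : HasSpectralDensity φ f) (hf : ∀ ξ, 0 ≤ f ξ) :
    IsPosDefFun φ := by
  refine ⟨?_, fun x => ?_⟩
  · ext u v
    simp only [Matrix.conjTranspose_apply, Matrix.of_apply, h.2, Complex.star_def]
    rw [← integral_conj]
    congr 1; ext ξ
    rw [map_mul, Complex.conj_ofReal, ← Complex.exp_conj, map_mul, Complex.conj_I,
      Complex.conj_ofReal]
    congr 2
    push_cast; ring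
  · have key : ∀ ξ, (∑ i ∈ x.support, ∑ j ∈ x.support, star (x i) *
        (Complex.exp ((2 * Real.pi * ξ * (i - j) : ℝ) * Complex.I) * (f ξ : ℂ)) * x j) =
        ((f ξ * Complex.normSq (∑ j ∈ x.support,
          Complex.exp (-((2 * Real.pi * ξ * j : ℝ) * Complex.I)) * x j) : ℝ) : ℂ) := by
      intro ξ
      rw [Complex.ofReal_mul, Complex.normSq_eq_conj_mul_self, map_sum, Finset.sum_mul_sum,
        Finset.mul_sum]
      refine Finset.sum_congr rfl fun i _ => ?_
      rw [Finset.mul_sum]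
      refine Finset.sum_congr rfl fun j _ => ?_
      rw [map_mul, ← Complex.exp_conj, map_neg, map_mul, Complex.conj_I, Complex.conj_ofReal,
        Complex.star_def,
        show ((2 * Real.pi * ξ * (i - j) : ℝ) : ℂ) * Complex.I =
          -(((2 * Real.pi * ξ * i : ℝ) : ℂ) * -Complex.I) + -(((2 * Real.pi * ξ * j : ℝ) : ℂ) *
            Complex.I) by push_cast; ring, Complex.exp_add]
      ring
    have hint : ∀ i j : ℝ, Integrable fun ξ => star (x i) *
        (Complex.exp ((2 * Real.pi * ξ * (i - j) : ℝ) * Complex.I) * (f ξ : ℂ)) * x j :=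
      fun i j => ((integrable_char_mul h.1 (i - j)).const_mul _).mul_const _
    have heq : (x.sum fun i xi => x.sum fun j xj => star xi * φ (i - j) * xj) =
        ∫ ξ, ((f ξ * Complex.normSq (∑ j ∈ x.support,
          Complex.exp (-((2 * Real.pi * ξ * j : ℝ) * Complex.I)) * x j) : ℝ) : ℂ) := by
      simp_rw [← key]
      rw [integral_finsetSum _ fun i _ => integrable_finsetSum _ fun j _ => hint i j]
      refine Finset.sum_congr rfl fun i _ => ?_
      rw [integral_finsetSum _ fun j _ => hint i j]
      refine Finset.sum_congr rfl fun j _ => ?_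
      simp only
      rw [integral_mul_const, integral_const_mul, h.2]
    simp only [Matrix.of_apply]
    rw [heq, integral_complex_ofReal]
    exact_mod_cast integral_nonneg fun ξ => mul_nonneg (hf ξ) (Complex.normSq_nonneg _)

/-- Term by term Fourier inversion of a series whose densities are dominated by a summable
multiple of a single integrable function. -/
lemma of_hasSum {φ : ℕ → ℝ → ℂ} {ψ : ℝ → ℂ} {f : ℕ → ℝ → ℝ} {u : ℕ → ℝ} {g F : ℝ → ℝ}
    (h : ∀ n, HasSpectralDensity (φ n) (f n)) (hu : Summable u) (hg : Integrable g)
    (hfu : ∀ n ξ, |f n ξ| ≤ u n * g ξ) (hF : ∀ ξ, HasSum (fun n => f n ξ) (F ξ))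
    (hsum : ∀ v, HasSum (fun n => φ n v) (ψ v)) : HasSpectralDensity ψ F := by
  have hb : Integrable fun ξ => ∑' n, u n * g ξ := by
    simp_rw [tsum_mul_right]; exact hg.const_mul _
  refine ⟨?_, fun v => ?_⟩
  · refine hb.mono' (aestronglyMeasurable_of_tendsto_ae atTop
      (f := fun n ξ => ∑ i ∈ Finset.range n, f i ξ) (fun n => ?_)
      (ae_of_all _ fun ξ => (hF ξ).tendsto_sum_nat)) (ae_of_all _ fun ξ => ?_)
    · exact (integrable_finsetSum _ fun i _ => (h i).1).aestronglyMeasurable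
    · rw [← (hF ξ).tsum_eq]
      exact tsum_of_norm_bounded (hu.mul_right (g ξ)).hasSum fun n => hfu n ξ
  · have := hasSum_integral_of_dominated_convergence (μ := volume)
      (F := fun n ξ => Complex.exp ((2 * Real.pi * ξ * v : ℝ) * Complex.I) * (f n ξ : ℂ))
      (f := fun ξ => Complex.exp ((2 * Real.pi * ξ * v : ℝ) * Complex.I) * (F ξ : ℂ))
      (fun n ξ => u n * g ξ) (fun n => (integrable_char_mul (h n).1 v).aestronglyMeasurable)
      (fun n => ae_of_all _ fun ξ => ?_) (ae_of_all _ fun ξ => hu.mul_right _) hb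
      (ae_of_all _ fun ξ => ((Complex.hasSum_ofReal.2 (hF ξ))).mul_left _)
    · refine (hsum v).unique ?_
      simpa only [(h _).2 v] using this
    · rw [norm_mul, Complex.norm_exp_ofReal_mul_I, one_mul, Complex.norm_real]
      exact hfu n ξ

/-- Fourier inversion. -/
lemma of_fourier {ψ : ℝ → ℂ} {f : ℝ → ℝ} (hc : Continuous ψ) (hψ : Integrable ψ)
    (hf : Integrable f)
    (h : ∀ ξ, ∫ v, Complex.exp ((-2 * Real.pi * v * ξ : ℝ) * Complex.I) • ψ v = f ξ) :
    HasSpectralDensity ψ f := by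
  have hF : 𝓕 ψ = fun ξ => (f ξ : ℂ) := by
    ext ξ
    rw [Real.fourier_real_eq_integral_exp_smul, h]
  refine ⟨hf, fun v => ?_⟩
  have hi := congrFun (hc.fourierInv_fourier_eq hψ (by rw [hF]; exact hf.ofReal)) v
  rw [hF, Real.fourierInv_eq'] at hi
  rw [← hi]
  congr 1; ext ξ
  rw [smul_eq_mul]
  congr 3
  simp; ring

end HasSpectralDensity

/-! ### Spectral densities of the even and odd exponentials -/

/-- `sgn v (e ^ (-a|v|) - e ^ (-b|v|))`. -/
noncomputable def oddExp (a b v : ℝ) : ℝ :=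
  Real.sign v * (Real.exp (-a * |v|) - Real.exp (-b * |v|))

lemma oddExp_eq (a b v : ℝ) : oddExp a b v =
    (Real.exp (-a * max v 0) - Real.exp (-b * max v 0)) -
      (Real.exp (-a * max (-v) 0) - Real.exp (-b * max (-v) 0)) := by
  rcases lt_trichotomy v 0 with h | rfl | h
  · simp [oddExp, Real.sign_of_neg h, abs_of_neg h, h.le]
  · simp [oddExp]
  · simp [oddExp, Real.sign_of_pos h, abs_of_pos h, h.le]

lemma integrable_lorentzian {a : ℝ} (ha : 0 < a) :
    Integrable fun ξ : ℝ => 1 / (a ^ 2 + (2 * Real.pi * ξ) ^ 2) := by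
  have h := (integrable_inv_one_add_sq.comp_mul_left' (R := 2 * Real.pi / a)
    (by positivity)).const_mul (1 / a ^ 2)
  refine h.congr (ae_of_all _ fun ξ => ?_)
  simp only
  field_simp

lemma integral_char_mul_eq_add {ψ : ℝ → ℂ} (hψ : Integrable ψ) (ξ : ℝ) :
    ∫ v, Complex.exp ((-2 * Real.pi * v * ξ : ℝ) * Complex.I) • ψ v =
      (∫ v in Set.Iic 0, Complex.exp ((-2 * Real.pi * v * ξ : ℝ) * Complex.I) * ψ v) +
      ∫ v in Set.Ioi 0, Complex.exp ((-2 * Real.pi * v * ξ : ℝ) * Complex.I) * ψ v := by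
  have hi : Integrable fun v => Complex.exp ((-2 * Real.pi * v * ξ : ℝ) * Complex.I) * ψ v := by
    refine hψ.bdd_mul (c := 1) (by fun_prop) (ae_of_all _ fun v => ?_)
    rw [Complex.norm_exp_ofReal_mul_I]
  exact (intervalIntegral.integral_Iic_add_Ioi hi.integrableOn hi.integrableOn).symm

lemma integrableOn_Ioi_char_mul_exp {a : ℝ} (ha : 0 < a) (ξ : ℝ) :
    IntegrableOn (fun v : ℝ => Complex.exp ((-2 * Real.pi * v * ξ : ℝ) * Complex.I) *
      (Real.exp (-a * v) : ℂ)) (Set.Ioi 0) := by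
  refine (integrableOn_exp_mul_complex_Ioi (a := -(a + 2 * Real.pi * ξ * Complex.I))
    (by simpa using ha) 0).congr_fun (fun v _ => ?_) measurableSet_Ioi
  simp only [Complex.ofReal_exp]
  rw [← Complex.exp_add]
  congr 1; push_cast; ring

lemma integral_Ioi_char_mul_exp {a : ℝ} (ha : 0 < a) (ξ : ℝ) :
    ∫ v in Set.Ioi (0 : ℝ), Complex.exp ((-2 * Real.pi * v * ξ : ℝ) * Complex.I) *
      (Real.exp (-a * v) : ℂ) = 1 / (a + 2 * Real.pi * ξ * Complex.I) := by
  have h := integral_exp_mul_complex_Ioi (a := -(a + 2 * Real.pi * ξ * Complex.I))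
    (by simpa using ha) 0
  rw [Complex.ofReal_zero, mul_zero, Complex.exp_zero, neg_div_neg_eq] at h
  rw [← h]
  refine setIntegral_congr_fun measurableSet_Ioi fun v _ => ?_
  simp only [Complex.ofReal_exp]
  rw [← Complex.exp_add]
  congr 1; push_cast; ring

lemma integrableOn_Iic_char_mul_exp {a : ℝ} (ha : 0 < a) (ξ : ℝ) :
    IntegrableOn (fun v : ℝ => Complex.exp ((-2 * Real.pi * v * ξ : ℝ) * Complex.I) *
      (Real.exp (a * v) : ℂ)) (Set.Iic 0) := by
  refine (integrableOn_exp_mul_complex_Iic (a := (a - 2 * Real.pi * ξ * Complex.I))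
    (by simpa using ha) 0).congr_fun (fun v _ => ?_) measurableSet_Iic
  simp only [Complex.ofReal_exp]
  rw [← Complex.exp_add]
  congr 1; push_cast; ring

lemma integral_Iic_char_mul_exp {a : ℝ} (ha : 0 < a) (ξ : ℝ) :
    ∫ v in Set.Iic (0 : ℝ), Complex.exp ((-2 * Real.pi * v * ξ : ℝ) * Complex.I) *
      (Real.exp (a * v) : ℂ) = 1 / (a - 2 * Real.pi * ξ * Complex.I) := by
  have h := integral_exp_mul_complex_Iic (a := (a - 2 * Real.pi * ξ * Complex.I))
    (by simpa using ha) 0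
  rw [Complex.ofReal_zero, mul_zero, Complex.exp_zero] at h
  rw [← h]
  refine setIntegral_congr_fun measurableSet_Iic fun v _ => ?_
  simp only [Complex.ofReal_exp]
  rw [← Complex.exp_add]
  congr 1; push_cast; ring

lemma add_mul_I_ne_zero {a : ℝ} (ha : 0 < a) (w : ℝ) : (a : ℂ) + w * Complex.I ≠ 0 := by
  intro h
  have := congrArg Complex.re h
  simp at this
  exact ha.ne' this

lemma inv_add_mul_I_add_inv {a : ℝ} (ha : 0 < a) (w : ℝ) :
    1 / ((a : ℂ) - w * Complex.I) + 1 / (a + w * Complex.I) =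
      ((2 * a * (1 / (a ^ 2 + w ^ 2)) : ℝ) : ℂ) := by
  have h1 := add_mul_I_ne_zero ha w
  have h2 : (a : ℂ) - w * Complex.I ≠ 0 := by simpa [sub_eq_add_neg] using add_mul_I_ne_zero ha (-w)
  have h3 : (a : ℂ) ^ 2 + (w : ℂ) ^ 2 = (a - w * Complex.I) * (a + w * Complex.I) := by
    linear_combination ((w : ℂ) ^ 2) * Complex.I_sq
  push_cast
  rw [h3]
  field_simp
  ring

lemma inv_add_mul_I_sub_inv {a : ℝ} (ha : 0 < a) (w : ℝ) :
    Complex.I * (1 / ((a : ℂ) + w * Complex.I) - 1 / (a - w * Complex.I)) =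
      ((2 * w * (1 / (a ^ 2 + w ^ 2)) : ℝ) : ℂ) := by
  have h1 := add_mul_I_ne_zero ha w
  have h2 : (a : ℂ) - w * Complex.I ≠ 0 := by simpa [sub_eq_add_neg] using add_mul_I_ne_zero ha (-w)
  have h3 : (a : ℂ) ^ 2 + (w : ℂ) ^ 2 = (a - w * Complex.I) * (a + w * Complex.I) := by
    linear_combination ((w : ℂ) ^ 2) * Complex.I_sq
  push_cast
  rw [h3]
  rw [div_sub_div _ _ h1 h2, mul_div_assoc', mul_one_div,
    div_eq_div_iff (mul_ne_zero h1 h2) (mul_ne_zero h2 h1)]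
  linear_combination (-2 * (w : ℂ) * (a - w * Complex.I) * (a + w * Complex.I)) * Complex.I_sq

lemma integrable_exp_neg_mul_abs {a : ℝ} (ha : 0 < a) :
    Integrable fun v : ℝ => ((Real.exp (-a * |v|) : ℝ) : ℂ) := by
  rw [← integrableOn_univ, ← Set.Iic_union_Ioi (a := (0 : ℝ))]
  refine IntegrableOn.union ?_ ?_
  · refine (integrableOn_Iic_char_mul_exp ha 0).congr_fun (fun v hv => ?_) measurableSet_Iic
    simp [abs_of_nonpos (Set.mem_Iic.1 hv)]
  · refine (integrableOn_Ioi_char_mul_exp ha 0).congr_fun (fun v hv => ?_) measurableSet_Ioi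
    simp [abs_of_pos (Set.mem_Ioi.1 hv)]

lemma hasSpectralDensity_exp {a : ℝ} (ha : 0 < a) :
    HasSpectralDensity (fun v => ((Real.exp (-a * |v|) : ℝ) : ℂ))
      (fun ξ => 2 * a * (1 / (a ^ 2 + (2 * Real.pi * ξ) ^ 2))) := by
  refine .of_fourier (by fun_prop) (integrable_exp_neg_mul_abs ha)
    ((integrable_lorentzian ha).const_mul _) fun ξ => ?_
  rw [integral_char_mul_eq_add (integrable_exp_neg_mul_abs ha), ← inv_add_mul_I_add_inv ha]
  push_cast
  rw [← integral_Iic_char_mul_exp ha, ← integral_Ioi_char_mul_exp ha]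
  congr 1
  · refine setIntegral_congr_fun measurableSet_Iic fun v hv => ?_
    simp [abs_of_nonpos (Set.mem_Iic.1 hv)]
  · refine setIntegral_congr_fun measurableSet_Ioi fun v hv => ?_
    simp [abs_of_pos (Set.mem_Ioi.1 hv)]

lemma integrable_oddExp_density {a b : ℝ} (ha : 0 < a) (hb : 0 < b) :
    Integrable fun ξ : ℝ => 2 * (2 * Real.pi * ξ) *
      (1 / (a ^ 2 + (2 * Real.pi * ξ) ^ 2) - 1 / (b ^ 2 + (2 * Real.pi * ξ) ^ 2)) := by
  refine ((integrable_lorentzian ha).const_mul (|b ^ 2 - a ^ 2| / b)).mono'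
    (by fun_prop (disch := intros; positivity)) (ae_of_all _ fun ξ => ?_)
  set w := 2 * Real.pi * ξ
  have hb' : 0 < b ^ 2 + w ^ 2 := by positivity
  have h2 : 2 * |w| * b ≤ b ^ 2 + w ^ 2 := by
    nlinarith [sq_nonneg (|w| - b), sq_abs w]
  have h3 : 2 * |w| / (b ^ 2 + w ^ 2) ≤ 1 / b := by
    rw [div_le_div_iff₀ hb' hb]; linarith
  have h1 : 2 * w * (1 / (a ^ 2 + w ^ 2) - 1 / (b ^ 2 + w ^ 2)) =
      (2 * w / (b ^ 2 + w ^ 2)) * ((b ^ 2 - a ^ 2) * (1 / (a ^ 2 + w ^ 2))) := by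
    field_simp; ring
  rw [h1, Real.norm_eq_abs, abs_mul, abs_mul, abs_div, abs_mul, abs_two, abs_of_pos hb',
    abs_of_pos (show 0 < 1 / (a ^ 2 + w ^ 2) by positivity)]
  calc _ ≤ 1 / b * (|b ^ 2 - a ^ 2| * (1 / (a ^ 2 + w ^ 2))) := by gcongr
    _ = _ := by ring

lemma hasSpectralDensity_oddExp {a b : ℝ} (ha : 0 < a) (hb : 0 < b) :
    HasSpectralDensity (fun v => Complex.I * (oddExp a b v : ℂ))
      (fun ξ => 2 * (2 * Real.pi * ξ) *
        (1 / (a ^ 2 + (2 * Real.pi * ξ) ^ 2) - 1 / (b ^ 2 + (2 * Real.pi * ξ) ^ 2))) := by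
  have hcont : Continuous fun v => Complex.I * (oddExp a b v : ℂ) := by
    simp_rw [oddExp_eq]; fun_prop
  have hint : Integrable fun v => Complex.I * (oddExp a b v : ℂ) := by
    refine (((integrable_exp_neg_mul_abs ha).norm).add
      (integrable_exp_neg_mul_abs hb).norm).mono' hcont.aestronglyMeasurable
      (ae_of_all _ fun v => ?_)
    have hs : |Real.sign v| ≤ 1 := by
      rcases Real.sign_apply_eq v with h | h | h <;> simp [h]
    simp only [oddExp, norm_mul, Complex.norm_I, one_mul, Complex.norm_real, Pi.add_apply,
      Real.norm_eq_abs, Complex.ofReal_mul]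
    calc _ ≤ 1 * |Real.exp (-a * |v|) - Real.exp (-b * |v|)| := by gcongr
      _ ≤ _ := by rw [one_mul]; exact abs_sub _ _
  refine .of_fourier hcont hint (integrable_oddExp_density ha hb) fun ξ => ?_
  have e1 : ∫ v in Set.Iic 0, Complex.exp ((-2 * Real.pi * v * ξ : ℝ) * Complex.I) *
      (Complex.I * (oddExp a b v : ℂ)) = -Complex.I * (1 / (a - 2 * Real.pi * ξ * Complex.I) -
        1 / (b - 2 * Real.pi * ξ * Complex.I)) := by
    rw [← integral_Iic_char_mul_exp ha, ← integral_Iic_char_mul_exp hb,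
      ← integral_sub (integrableOn_Iic_char_mul_exp ha ξ) (integrableOn_Iic_char_mul_exp hb ξ),
      ← integral_const_mul]
    refine setIntegral_congr_fun measurableSet_Iic fun v hv => ?_
    rw [Set.mem_Iic] at hv
    simp only [oddExp_eq, max_eq_right hv, max_eq_left (neg_nonneg.2 hv)]
    simp
    ring
  have e2 : ∫ v in Set.Ioi 0, Complex.exp ((-2 * Real.pi * v * ξ : ℝ) * Complex.I) *
      (Complex.I * (oddExp a b v : ℂ)) = Complex.I * (1 / (a + 2 * Real.pi * ξ * Complex.I) -
        1 / (b + 2 * Real.pi * ξ * Complex.I)) := by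
    rw [← integral_Ioi_char_mul_exp ha, ← integral_Ioi_char_mul_exp hb,
      ← integral_sub (integrableOn_Ioi_char_mul_exp ha ξ) (integrableOn_Ioi_char_mul_exp hb ξ),
      ← integral_const_mul]
    refine setIntegral_congr_fun measurableSet_Ioi fun v hv => ?_
    rw [Set.mem_Ioi] at hv
    simp only [oddExp_eq, max_eq_left hv.le, max_eq_right (neg_nonpos.2 hv.le)]
    simp
    ring
  rw [integral_char_mul_eq_add hint, e1, e2, mul_sub (2 * (2 * Real.pi * ξ)), Complex.ofReal_sub,
    ← inv_add_mul_I_sub_inv ha, ← inv_add_mul_I_sub_inv hb]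
  push_cast
  ring

/-! ### Expansions of `F_H` and `G_H` -/

/-- The odd function `F_H(v) e ^ (-H|v|) sinh (H v)`, so that
`R_θ(v) = (F_{H₁}(v₁) F_{H₂}(v₂) + θ G_{H₁}(v₁) G_{H₂}(v₂)) / 4`. -/
noncomputable def covG (H v : ℝ) : ℝ :=
  covF H v * (Real.exp (-H * |v|) * Real.sinh (H * v))

lemma covF_eq {H : ℝ} (v : ℝ) : covF H v =
    Real.exp (-H * |v|) + Real.exp (H * |v|) * (1 - (1 - Real.exp (-|v|)) ^ (2 * H)) := by
  have h1 : |Real.exp (v / 2) - Real.exp (-(v / 2))| =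
      Real.exp (|v| / 2) * (1 - Real.exp (-|v|)) := by
    have h3 : ∀ x : ℝ, Real.exp (x / 2) * (1 - Real.exp (-x)) =
        Real.exp (x / 2) - Real.exp (-(x / 2)) := by
      intro x
      rw [mul_sub, mul_one, ← Real.exp_add]
      congr 2; ring
    rw [h3]
    rcases le_total 0 v with h | h
    · rw [abs_of_nonneg h, abs_of_nonneg]
      simpa using by linarith
    · rw [abs_of_nonpos h, abs_of_nonpos]
      · rw [neg_sub, neg_div, neg_neg]
      · simpa using by linarith
  have h2 : (0 : ℝ) ≤ 1 - Real.exp (-|v|) := by simp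
  have h4 : Real.exp (H * v) + Real.exp (-(H * v)) =
      Real.exp (-H * |v|) + Real.exp (H * |v|) := by
    rcases le_total 0 v with h | h
    · rw [abs_of_nonneg h, neg_mul, add_comm]
    · rw [abs_of_nonpos h]; simp
  rw [covF, h1, h4, Real.mul_rpow (Real.exp_pos _).le h2, ← Real.exp_mul,
    show |v| / 2 * (2 * H) = H * |v| by ring]
  ring

lemma covF_neg (H v : ℝ) : covF H (-v) = covF H v := by
  simp [covF_eq]

lemma covF_pos {H : ℝ} (hH : 0 < H) (v : ℝ) : 0 < covF H v := by
  rw [covF_eq]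
  have h : (1 - Real.exp (-|v|)) ^ (2 * H) ≤ 1 :=
    Real.rpow_le_one (by simp) (by linarith [Real.exp_pos (-|v|)]) (by linarith)
  have := Real.exp_pos (H * |v|)
  have := Real.exp_pos (-H * |v|)
  nlinarith

/-- `F_H` is `e ^ (-H|v|)` plus a series of exponentials `e ^ (-(n + 1 - H)|v|)`. -/
lemma hasSum_covF {H : ℝ} (h0 : 0 < H) (h1 : H < 1) (v : ℝ) :
    HasSum (fun n : ℕ => binomCoeff (2 * H) n * Real.exp (-((n : ℝ) + 1 - H) * |v|))
      (covF H v - Real.exp (-H * |v|)) := by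
  have h := (hasSum_binomCoeff_mul_pow (α := 2 * H) (x := Real.exp (-|v|)) (by linarith)
    (by linarith) (Real.exp_pos _).le (by simp)).mul_left (Real.exp (H * |v|))
  rw [covF_eq, add_sub_cancel_left]
  convert! h using 1
  ext n
  rw [← Real.exp_nat_mul, mul_left_comm, ← Real.exp_add]
  congr 2
  push_cast; ring

lemma exp_mul_oddWeight (c H v : ℝ) :
    Real.exp (-c * |v|) * (Real.exp (-H * |v|) * Real.sinh (H * v)) =
      1 / 2 * oddExp c (c + 2 * H) v := by
  have key : Real.exp (-H * |v|) * Real.sinh (H * v) =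
      1 / 2 * (Real.sign v * (1 - Real.exp (-(2 * H) * |v|))) := by
    rw [Real.sinh_eq]
    rcases lt_trichotomy v 0 with h | rfl | h
    · rw [Real.sign_of_neg h, abs_of_neg h, mul_div_assoc', mul_sub, ← Real.exp_add,
        ← Real.exp_add, show -H * -v + -(H * v) = 0 by ring, Real.exp_zero,
        show -H * -v + H * v = -(2 * H) * -v by ring]
      ring
    · simp
    · rw [Real.sign_of_pos h, abs_of_pos h, mul_div_assoc', mul_sub, ← Real.exp_add,
        ← Real.exp_add, show -H * v + H * v = 0 by ring, Real.exp_zero,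
        show -H * v + -(H * v) = -(2 * H) * v by ring]
      ring
  rw [key, oddExp, show -(c + 2 * H) * |v| = -c * |v| + -(2 * H) * |v| by ring, Real.exp_add]
  ring

lemma hasSum_covG {H : ℝ} (h0 : 0 < H) (h1 : H < 1) (v : ℝ) :
    HasSum (fun n : ℕ => 1 / 2 * binomCoeff (2 * H) n *
        oddExp ((n : ℝ) + 1 - H) ((n : ℝ) + 1 + H) v)
      (covG H v - 1 / 2 * oddExp H (3 * H) v) := by
  have h := (hasSum_covF h0 h1 v).mul_right (Real.exp (-H * |v|) * Real.sinh (H * v))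
  rw [sub_mul, exp_mul_oddWeight, show H + 2 * H = 3 * H by ring] at h
  convert! h using 1
  ext n
  rw [mul_assoc (binomCoeff _ _), exp_mul_oddWeight,
    show (n : ℝ) + 1 - H + 2 * H = n + 1 + H by ring]
  ring

/-! ### Domination of `G_H` by `F_H` when `H ≤ 1 / 2` -/

/-- When `a ≤ b ≤ 3a`, the spectral density of `e ^ (-a|v|)` dominates that of `oddExp a b / 2`.
The bound `3` is attained by the pairs `(H, 3H)` and, for `H = 1 / 2`, `(1 - H, 1 + H)`. -/
lemma isPosDefFun_exp_add_oddExp {a b : ℝ} (ha : 0 < a) (hab : a ≤ b) (hb : b ≤ 3 * a) :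
    IsPosDefFun fun v => ((Real.exp (-a * |v|) : ℝ) : ℂ) +
      ((1 / 2 : ℝ) : ℂ) * (Complex.I * (oddExp a b v : ℂ)) := by
  refine ((hasSpectralDensity_exp ha).add ((hasSpectralDensity_oddExp ha
    (ha.trans_le hab)).smul (1 / 2))).isPosDefFun fun ξ => ?_
  set w := 2 * Real.pi * ξ
  have hb0 := ha.trans_le hab
  have e : 2 * a * (1 / (a ^ 2 + w ^ 2)) + 1 / 2 * (2 * w *
      (1 / (a ^ 2 + w ^ 2) - 1 / (b ^ 2 + w ^ 2))) =
      (2 * a * (b ^ 2 + w ^ 2) + w * (b ^ 2 - a ^ 2)) / ((a ^ 2 + w ^ 2) * (b ^ 2 + w ^ 2)) := by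
    field_simp
    ring
  rw [e]
  refine div_nonneg ?_ (by positivity)
  -- `|w| (b² - a²) ≤ |w| b · 3a ≤ 2a (b² + w²)`
  have h1 : |w| * (b ^ 2 - a ^ 2) ≤ |w| * (3 * a * b) := by
    gcongr; nlinarith
  have h2 : |w| * (3 * a * b) ≤ 2 * a * (b ^ 2 + w ^ 2) := by
    have : 3 * (|w| * b) ≤ 2 * (b ^ 2 + w ^ 2) := by
      nlinarith [sq_nonneg (|w| - b), sq_abs w, sq_nonneg b, sq_nonneg w]
    nlinarith
  have h3 : -(|w| * (b ^ 2 - a ^ 2)) ≤ w * (b ^ 2 - a ^ 2) := by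
    rw [← neg_mul]
    exact mul_le_mul_of_nonneg_right (neg_abs_le w) (by nlinarith)
  linarith

/-- For `H ≤ 1 / 2` the coefficients `binomCoeff (2 * H) n` are nonnegative, so the domination can
be made term by term. -/
lemma isPosDefFun_covF_add_covG_of_le_half {H : ℝ} (h0 : 0 < H) (h1 : H ≤ 1 / 2) :
    IsPosDefFun fun v => (covF H v : ℂ) + Complex.I * (covG H v : ℂ) := by
  have hsum : ∀ v, HasSum (fun n : ℕ => ((binomCoeff (2 * H) n : ℝ) : ℂ) *
      (((Real.exp (-((n : ℝ) + 1 - H) * |v|) : ℝ) : ℂ) + ((1 / 2 : ℝ) : ℂ) *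
        (Complex.I * (oddExp ((n : ℝ) + 1 - H) ((n : ℝ) + 1 + H) v : ℂ))))
      (((covF H v - Real.exp (-H * |v|) : ℝ) : ℂ) +
        Complex.I * ((covG H v - 1 / 2 * oddExp H (3 * H) v : ℝ) : ℂ)) := by
    intro v
    convert! (Complex.hasSum_ofReal.2 (hasSum_covF h0 (by linarith) v)).add
      ((Complex.hasSum_ofReal.2 (hasSum_covG h0 (by linarith) v)).mul_left Complex.I) using 1
    ext n
    push_cast
    ring
  have h := (isPosDefFun_exp_add_oddExp h0 (by linarith : H ≤ 3 * H) le_rfl).add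
    (IsPosDefFun.of_hasSum (fun n => (isPosDefFun_exp_add_oddExp (a := (n : ℝ) + 1 - H)
      (b := (n : ℝ) + 1 + H) (by linarith [(Nat.cast_nonneg n : (0 : ℝ) ≤ n)]) (by linarith)
      (by linarith [(Nat.cast_nonneg n : (0 : ℝ) ≤ n)])).smul
      (binomCoeff_nonneg (α := 2 * H) (by linarith) (by linarith) n)) hsum)
  convert h using 1
  ext v
  push_cast
  ring

/-! ### Domination of `G_H` by `F_H` when `1 / 2 < H` -/

/-- For `1 < α < 2` all the products with at least one factor are negative, and they decay no faster
than a multiple of `1 / j ^ 2`. The ratio of consecutive values of `-(j + 1) binomProd α (j + 1)` is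
`(j + 2 - α) / (j + 1)`, which is at least `j / (j + 1)`; so these values decay no faster than
`1 / j`. -/
lemma le_neg_mul_binomProd_succ {α : ℝ} (h1 : 1 < α) (h2 : α < 2) (j : ℕ) :
    (α - 1) * (2 - α) / (j + 1) ≤ -((j + 1) * binomProd α (j + 1)) := by
  have hrec : ∀ j : ℕ, -(((j + 1 : ℕ) + 1 : ℝ) * binomProd α (j + 1 + 1)) =
      -((j + 1) * binomProd α (j + 1)) * ((j + 2 - α) / (j + 1)) := by
    intro j
    rw [binomProd_succ α (j + 1)]
    push_cast
    field_simp
    ring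
  have hsucc : ∀ j : ℕ, (α - 1) * (2 - α) / ((j + 1 : ℕ) + 1) ≤ (α - 1) * (2 - α) / (j + 1) := by
    intro j
    have : 0 ≤ (α - 1) * (2 - α) := mul_nonneg (by linarith) (by linarith)
    gcongr
    linarith
  -- The lower bound `j / (j + 1)` for the ratio vanishes at `j = 0`, so the induction starts at `1`.
  have key : ∀ j : ℕ, (α - 1) * (2 - α) / (j + 1) ≤
      -(((j + 1 : ℕ) + 1 : ℝ) * binomProd α (j + 1 + 1)) := by
    intro j
    induction j with
    | zero =>
      rw [hrec]
      simp [binomProd_succ]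
    | succ j ih =>
      rw [hrec (j + 1)]
      have hj : (0 : ℝ) ≤ j := Nat.cast_nonneg j
      calc (α - 1) * (2 - α) / ((j + 1 : ℕ) + 1)
          = (α - 1) * (2 - α) / (j + 1) * ((j + 1) / (j + 2)) := by push_cast; field_simp; ring
        _ ≤ (-(((j + 1 : ℕ) + 1 : ℝ) * binomProd α (j + 1 + 1))) *
            (((j + 1 : ℕ) + 2 - α) / ((j + 1 : ℕ) + 1)) := by
          refine mul_le_mul ih ?_ (by positivity) (le_trans ?_ ih)
          · push_cast
            rw [div_le_div_iff₀ (by positivity) (by positivity)]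
            nlinarith
          · exact div_nonneg (mul_nonneg (by linarith) (by linarith)) (by positivity)
  cases j with
  | zero =>
    simp [binomProd_succ]
    nlinarith
  | succ j => exact (hsucc j).trans (key j)

lemma exists_le_sum_inv_sq_add_sq {w : ℝ} (hw : 0 ≤ w) :
    ∃ N : ℕ, 1 / (2 * (1 + w)) ≤ ∑ j ∈ Finset.range N, 1 / (((j : ℝ) + 1) ^ 2 + w ^ 2) := by
  -- Each of the first `⌊w⌋ + 1` terms is at least `1 / (2 N²)` with `N = ⌊w⌋ + 1`.
  refine ⟨⌊w⌋₊ + 1, ?_⟩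
  have h1 : w ≤ (⌊w⌋₊ + 1 : ℕ) := by push_cast; exact (Nat.lt_floor_add_one w).le
  have h2 : ((⌊w⌋₊ + 1 : ℕ) : ℝ) ≤ 1 + w := by push_cast; linarith [Nat.floor_le hw]
  have h3 : 0 < ((⌊w⌋₊ + 1 : ℕ) : ℝ) := by positivity
  generalize ⌊w⌋₊ + 1 = N at h1 h2 h3
  have hterm : ∀ j ∈ Finset.range N, 1 / (2 * (N : ℝ) ^ 2) ≤ 1 / (((j : ℝ) + 1) ^ 2 + w ^ 2) := by
    intro j hj
    have hj' : (j : ℝ) + 1 ≤ N := by exact_mod_cast Finset.mem_range.1 hj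
    gcongr
    nlinarith [(Nat.cast_nonneg j : (0 : ℝ) ≤ j)]
  calc 1 / (2 * (1 + w)) ≤ 1 / (2 * (N : ℝ)) := by gcongr
    _ = ∑ j ∈ Finset.range N, 1 / (2 * (N : ℝ) ^ 2) := by
      rw [Finset.sum_const, Finset.card_range, nsmul_eq_mul]; field_simp
    _ ≤ _ := Finset.sum_le_sum hterm

/-- The density of the `j`-th term in the expansion of `F_H` used for `1 / 2 < H`. Each of them is
nonnegative, because `binomProd (2 * H) (j + 1) ≤ 0`. -/
noncomputable def covFDensity (H : ℝ) (j : ℕ) (ξ : ℝ) : ℝ :=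
  4 * H * ((j : ℝ) + 1 - H) * -((j + 1) * binomProd (2 * H) (j + 1)) /
    ((H ^ 2 + (2 * Real.pi * ξ) ^ 2) * (((j : ℝ) + 1 - H) ^ 2 + (2 * Real.pi * ξ) ^ 2))

lemma neg_mul_binomProd_succ_nonneg {α : ℝ} (h1 : 1 < α) (h2 : α < 2) (j : ℕ) :
    0 ≤ -(((j : ℝ) + 1) * binomProd α (j + 1)) :=
  le_trans (div_nonneg (mul_nonneg (by linarith) (by linarith)) (by positivity))
    (le_neg_mul_binomProd_succ h1 h2 j)

lemma covFDensity_nonneg {H : ℝ} (h0 : 1 / 2 < H) (h1 : H < 1) (j : ℕ) (ξ : ℝ) :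
    0 ≤ covFDensity H j ξ := by
  have h := neg_mul_binomProd_succ_nonneg (α := 2 * H) (by linarith) (by linarith) j
  have hj : 0 ≤ (j : ℝ) + 1 - H := by linarith [(Nat.cast_nonneg j : (0 : ℝ) ≤ j)]
  exact div_nonneg (mul_nonneg (mul_nonneg (by linarith) hj) h) (by positivity)

lemma covFDensity_le {H : ℝ} (h0 : 1 / 2 < H) (h1 : H < 1) (j : ℕ) (ξ : ℝ) :
    |covFDensity H j ξ| ≤ 4 * H / (1 - H) * |binomProd (2 * H) (j + 1)| *
      (1 / (H ^ 2 + (2 * Real.pi * ξ) ^ 2)) := by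
  have h := neg_mul_binomProd_succ_nonneg (α := 2 * H) (by linarith) (by linarith) j
  have hj0 : (0 : ℝ) ≤ j := Nat.cast_nonneg j
  have hj : 0 < (j : ℝ) + 1 - H := by linarith
  have hH : 0 < 1 - H := by linarith
  have hle : ((j : ℝ) + 1) * (1 - H) ≤ j + 1 - H := by nlinarith
  rw [abs_of_nonneg (covFDensity_nonneg h0 h1 j ξ), covFDensity]
  set w := 2 * Real.pi * ξ
  have hP : -((j + 1) * binomProd (2 * H) (j + 1)) = (j + 1) * |binomProd (2 * H) (j + 1)| := by
    rw [abs_of_nonpos, mul_neg]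
    by_contra hc
    push Not at hc
    nlinarith
  rw [hP]
  set p := |binomProd (2 * H) (j + 1)|
  have hp : 0 ≤ p := abs_nonneg _
  set m := (j : ℝ) + 1 - H
  have hm : m * (j + 1) / (m ^ 2 + w ^ 2) ≤ 1 / (1 - H) := by
    rw [div_le_div_iff₀ (by positivity) hH]
    nlinarith [sq_nonneg w]
  calc 4 * H * m * ((j + 1) * p) / ((H ^ 2 + w ^ 2) * (m ^ 2 + w ^ 2))
      = 4 * H * p * (1 / (H ^ 2 + w ^ 2)) * (m * (j + 1) / (m ^ 2 + w ^ 2)) := by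
        field_simp
    _ ≤ 4 * H * p * (1 / (H ^ 2 + w ^ 2)) * (1 / (1 - H)) := by gcongr
    _ = _ := by ring

lemma summable_abs_binomProd_succ {H : ℝ} (h0 : 1 / 2 < H) (h1 : H < 1) :
    Summable fun j : ℕ => 4 * H / (1 - H) * |binomProd (2 * H) (j + 1)| :=
  (((summable_nat_add_iff 1).2 (hasSum_binomProd (α := 2 * H) (by linarith)
    (by linarith)).summable).abs).mul_left _

lemma summable_covFDensity {H : ℝ} (h0 : 1 / 2 < H) (h1 : H < 1) (ξ : ℝ) :
    Summable fun j => covFDensity H j ξ :=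
  .of_norm_bounded ((summable_abs_binomProd_succ h0 h1).mul_right _) fun j =>
    covFDensity_le h0 h1 j ξ

/-- For `1 / 2 < H` the exponentials in the expansion of `F_H` have coefficients of both signs.
Since `∑ (n + 1) a_n = 0` and `∑ a_n = 1`, where `a_n = binomCoeff (2 * H) n`, the leading
exponential `e ^ (-H|v|)` can be distributed over the series so that each term becomes a
nonnegative multiple of the positive definite function
`(m e ^ (-H|v|) - H e ^ (-m|v|)) / (m² - H²)` with `m = n + 1 - H`. -/
lemma hasSpectralDensity_covF {H : ℝ} (h0 : 1 / 2 < H) (h1 : H < 1) :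
    HasSpectralDensity (fun v => (covF H v : ℂ)) (fun ξ => ∑' j, covFDensity H j ξ) := by
  have hH0 : 0 < H := by linarith
  have hm : ∀ j : ℕ, 0 < (j : ℝ) + 1 - H := fun j => by
    linarith [(Nat.cast_nonneg j : (0 : ℝ) ≤ j)]
  have hterm : ∀ j : ℕ, HasSpectralDensity
      (fun v => ((binomCoeff (2 * H) j : ℝ) : ℂ) * ((Real.exp (-((j : ℝ) + 1 - H) * |v|) : ℝ) : ℂ) +
        ((-(binomCoeff (2 * H) j * ((j : ℝ) + 1 - H) / H) : ℝ) : ℂ) *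
          ((Real.exp (-H * |v|) : ℝ) : ℂ)) (covFDensity H j) := by
    intro j
    convert ((hasSpectralDensity_exp (hm j)).smul (binomCoeff (2 * H) j)).add
      ((hasSpectralDensity_exp hH0).smul (-(binomCoeff (2 * H) j * ((j : ℝ) + 1 - H) / H))) using 1
    ext ξ
    have := hm j
    rw [covFDensity, binomCoeff, binomProd_succ]
    generalize binomProd (2 * H) j = p
    generalize (2 * Real.pi * ξ) = w
    have e1 : 0 < H ^ 2 + w ^ 2 := by positivity
    have e2 : 0 < ((j : ℝ) + 1 - H) ^ 2 + w ^ 2 := by positivity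
    field_simp
    ring
  refine .of_hasSum hterm (summable_abs_binomProd_succ h0 h1) (integrable_lorentzian hH0)
    (covFDensity_le h0 h1) (fun ξ => (summable_covFDensity h0 h1 ξ).hasSum) fun v => ?_
  have s1 := hasSum_covF hH0 h1 v
  have s2 := hasSum_binomCoeff (α := 2 * H) (by linarith) (by linarith)
  have s3 := (hasSum_binomProd (α := 2 * H) (by linarith) (by linarith)).mul_left (2 * H)
  simp_rw [← add_one_mul_binomCoeff] at s3
  have s4 := Complex.hasSum_ofReal.2 (s1.add
    ((((s2.mul_left H).sub s3).mul_left (1 / H)).mul_right (Real.exp (-H * |v|))))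
  convert! s4 using 1
  · ext n
    push_cast
    field_simp
    ring
  · push_cast
    field_simp
    ring

/-- The spectral density of `F_H` decays no faster than `|w| ^ (-3)`, in the frequency `w = 2πξ`.
A single term of the series decays like `w ^ (-4)`; the terms with `j ≤ |w|` together give the
missing power. -/
lemma exists_le_tsum_covFDensity {H : ℝ} (h0 : 1 / 2 < H) (h1 : H < 1) :
    ∃ c : ℝ, 0 < c ∧ ∀ ξ, c / ((H ^ 2 + (2 * Real.pi * ξ) ^ 2) * (1 + |2 * Real.pi * ξ|)) ≤
      ∑' j, covFDensity H j ξ := by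
  have hH : 0 < 1 - H := by linarith
  have hH' : 0 < (2 * H - 1) * (2 - 2 * H) := mul_pos (by linarith) (by linarith)
  set c := (2 * H - 1) * (2 - 2 * H)
  refine ⟨4 * H * (1 - H) * c * (1 / 2), by positivity, fun ξ => ?_⟩
  obtain ⟨N, hN⟩ := exists_le_sum_inv_sq_add_sq (abs_nonneg (2 * Real.pi * ξ))
  refine le_trans ?_ ((summable_covFDensity h0 h1 ξ).sum_le_tsum (Finset.range N)
    fun j _ => covFDensity_nonneg h0 h1 j ξ)
  have hterm : ∀ j ∈ Finset.range N, 4 * H * (1 - H) * c / (H ^ 2 + (2 * Real.pi * ξ) ^ 2) *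
      (1 / (((j : ℝ) + 1) ^ 2 + |2 * Real.pi * ξ| ^ 2)) ≤ covFDensity H j ξ := by
    intro j _
    have h := le_neg_mul_binomProd_succ (α := 2 * H) (by linarith) (by linarith) j
    have hj0 : (0 : ℝ) ≤ j := Nat.cast_nonneg j
    have hj : 0 < (j : ℝ) + 1 - H := by linarith
    have hle : (1 - H) * ((j : ℝ) + 1) ≤ j + 1 - H := by nlinarith
    rw [sq_abs, covFDensity]
    generalize 2 * Real.pi * ξ = w
    have hD := neg_mul_binomProd_succ_nonneg (α := 2 * H) (by linarith) (by linarith) j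
    generalize -(((j : ℝ) + 1) * binomProd (2 * H) (j + 1)) = D at h hD
    have hle' : (j : ℝ) + 1 - H ≤ j + 1 := by linarith
    generalize (j : ℝ) + 1 - H = m at hj hle hle'
    calc 4 * H * (1 - H) * c / (H ^ 2 + w ^ 2) * (1 / (((j : ℝ) + 1) ^ 2 + w ^ 2))
        = 4 * H * ((1 - H) * (j + 1)) * (c / (j + 1)) /
          ((H ^ 2 + w ^ 2) * (((j : ℝ) + 1) ^ 2 + w ^ 2)) := by field_simp
      _ ≤ _ := by
        gcongr
  refine le_trans ?_ (Finset.sum_le_sum hterm)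
  rw [← Finset.mul_sum]
  calc _ = 4 * H * (1 - H) * c / (H ^ 2 + (2 * Real.pi * ξ) ^ 2) *
        (1 / (2 * (1 + |2 * Real.pi * ξ|))) := by field_simp
    _ ≤ _ := by gcongr

/-- For `1 / 2 < H` the spectral density of `F_H` dominates those of all the functions `oddExp a b`
with `a` bounded below, with a constant proportional to `b² - a²`. -/
lemma exists_isPosDefFun_covF_add_oddExp {H : ℝ} (h0 : 1 / 2 < H) (h1 : H < 1) :
    ∃ C : ℝ, 0 < C ∧ ∀ a b t : ℝ, 1 - H ≤ a → H ≤ b → a ≤ b →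
      IsPosDefFun fun v => ((C * (|t| * (b ^ 2 - a ^ 2)) : ℝ) : ℂ) * (covF H v : ℂ) +
        (t : ℂ) * (Complex.I * (oddExp a b v : ℂ)) := by
  obtain ⟨c, hc, hcle⟩ := exists_le_tsum_covFDensity h0 h1
  have hH : 0 < 1 - H := by linarith
  refine ⟨4 / ((1 - H) ^ 2 * c), by positivity, fun a b t ha hb hab => ?_⟩
  have ha0 : 0 < a := by linarith
  have hb0 : 0 < b := by linarith
  have hba : 0 ≤ b ^ 2 - a ^ 2 := by nlinarith
  refine (((hasSpectralDensity_covF h0 h1).smul _).add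
    ((hasSpectralDensity_oddExp ha0 hb0).smul t)).isPosDefFun fun ξ => ?_
  have hf := hcle ξ
  generalize ∑' j, covFDensity H j ξ = f at hf
  generalize 2 * Real.pi * ξ = w at hf
  -- `|w| (1 + |w|) ≤ 2 (1 + w²) ≤ 2 (1 - H)⁻² (a² + w²)`
  have k1 : |w| * (1 + |w|) * (1 - H) ^ 2 ≤ 2 * (a ^ 2 + w ^ 2) := by
    have e1 : |w| * (1 + |w|) ≤ 2 * (1 + w ^ 2) := by
      nlinarith [sq_abs w, sq_nonneg (|w| - 1)]
    have e2 : (1 - H) ^ 2 ≤ a ^ 2 := by gcongr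
    have e3 : (1 - H) ^ 2 ≤ 1 := by nlinarith
    calc _ ≤ 2 * (1 + w ^ 2) * (1 - H) ^ 2 := by gcongr
      _ ≤ _ := by nlinarith [sq_nonneg w]
  have k2 : 2 * |w| * (b ^ 2 - a ^ 2) / ((a ^ 2 + w ^ 2) * (b ^ 2 + w ^ 2)) ≤
      4 / ((1 - H) ^ 2 * c) * (b ^ 2 - a ^ 2) * f := by
    calc 2 * |w| * (b ^ 2 - a ^ 2) / ((a ^ 2 + w ^ 2) * (b ^ 2 + w ^ 2))
        ≤ 4 * (b ^ 2 - a ^ 2) / ((1 - H) ^ 2 * ((H ^ 2 + w ^ 2) * (1 + |w|))) := by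
          rw [div_le_div_iff₀ (by positivity) (by positivity)]
          calc _ = 2 * (b ^ 2 - a ^ 2) * (|w| * (1 + |w|) * (1 - H) ^ 2) * (H ^ 2 + w ^ 2) := by
                ring
            _ ≤ 2 * (b ^ 2 - a ^ 2) * (2 * (a ^ 2 + w ^ 2)) * (b ^ 2 + w ^ 2) := by gcongr
            _ = _ := by ring
      _ = 4 / ((1 - H) ^ 2 * c) * (b ^ 2 - a ^ 2) *
          (c / ((H ^ 2 + w ^ 2) * (1 + |w|))) := by field_simp
      _ ≤ _ := by gcongr
  have k3 : |t * (2 * w * (1 / (a ^ 2 + w ^ 2) - 1 / (b ^ 2 + w ^ 2)))| =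
      |t| * (2 * |w| * (b ^ 2 - a ^ 2) / ((a ^ 2 + w ^ 2) * (b ^ 2 + w ^ 2))) := by
    rw [show 2 * w * (1 / (a ^ 2 + w ^ 2) - 1 / (b ^ 2 + w ^ 2)) =
      w * (2 * (b ^ 2 - a ^ 2) / ((a ^ 2 + w ^ 2) * (b ^ 2 + w ^ 2))) by field_simp; ring,
      abs_mul, abs_mul, abs_of_nonneg (by positivity :
        0 ≤ 2 * (b ^ 2 - a ^ 2) / ((a ^ 2 + w ^ 2) * (b ^ 2 + w ^ 2)))]
    ring
  have k4 := mul_le_mul_of_nonneg_left k2 (abs_nonneg t)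
  rw [← k3] at k4
  linarith [neg_abs_le (t * (2 * w * (1 / (a ^ 2 + w ^ 2) - 1 / (b ^ 2 + w ^ 2))))]

/-- The densities of the terms of `G_H` are dominated one at a time by the density of `F_H`; the
constants add up because `∑ (n + 1) |a_n| < ∞`, where `a_n = binomCoeff (2 * H) n`. -/
lemma exists_isPosDefFun_of_half_lt {H : ℝ} (h0 : 1 / 2 < H) (h1 : H < 1) :
    ∃ C : ℝ, 0 < C ∧
      IsPosDefFun fun v => ((C * covF H v : ℝ) : ℂ) + Complex.I * (covG H v : ℂ) := by
  obtain ⟨C, hC, hpd⟩ := exists_isPosDefFun_covF_add_oddExp h0 h1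
  have hS := (summable_add_one_mul_abs_binomCoeff (α := 2 * H) (by linarith) (by linarith)).hasSum
  set S := ∑' n : ℕ, ((n : ℝ) + 1) * |binomCoeff (2 * H) n|
  have hS0 : 0 ≤ S := tsum_nonneg fun n => by positivity
  refine ⟨C * (4 * H ^ 2) + C * (2 * H) * S, by positivity, ?_⟩
  have hsum : ∀ v, HasSum (fun n : ℕ => ((C * (|1 / 2 * binomCoeff (2 * H) n| *
        (((n : ℝ) + 1 + H) ^ 2 - ((n : ℝ) + 1 - H) ^ 2)) : ℝ) : ℂ) * (covF H v : ℂ) +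
        ((1 / 2 * binomCoeff (2 * H) n : ℝ) : ℂ) *
          (Complex.I * (oddExp ((n : ℝ) + 1 - H) ((n : ℝ) + 1 + H) v : ℂ)))
      (((C * (2 * H) * S * covF H v : ℝ) : ℂ) +
        Complex.I * ((covG H v - 1 / 2 * oddExp H (3 * H) v : ℝ) : ℂ)) := by
    intro v
    convert! (Complex.hasSum_ofReal.2 ((hS.mul_left (C * (2 * H))).mul_right (covF H v))).add
      ((Complex.hasSum_ofReal.2 (hasSum_covG (by linarith) h1 v)).mul_left Complex.I) using 1
    ext n
    rw [abs_mul, abs_of_pos (by norm_num : (0 : ℝ) < 1 / 2)]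
    push_cast
    ring
  have h := (hpd H (3 * H) (1 / 2) (by linarith) (by linarith) (by linarith)).add
    (IsPosDefFun.of_hasSum (fun n : ℕ => hpd ((n : ℝ) + 1 - H) ((n : ℝ) + 1 + H)
      (1 / 2 * binomCoeff (2 * H) n) (by linarith [(Nat.cast_nonneg n : (0 : ℝ) ≤ n)])
      (by linarith [(Nat.cast_nonneg n : (0 : ℝ) ≤ n)]) (by linarith)) hsum)
  convert h using 1
  ext v
  rw [abs_of_pos (by norm_num : (0 : ℝ) < 1 / 2)]
  push_cast
  ring

/-- The Fourier transform of the odd function `G_H` is bounded in modulus by a multiple of that of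
`F_H`. -/
lemma exists_isPosDefFun_covF_add_covG {H : ℝ} (h0 : 0 < H) (h1 : H < 1) :
    ∃ C : ℝ, 0 < C ∧
      IsPosDefFun fun v => ((C * covF H v : ℝ) : ℂ) + Complex.I * (covG H v : ℂ) := by
  rcases le_or_gt H (1 / 2) with h | h
  · exact ⟨1, one_pos, by simpa using isPosDefFun_covF_add_covG_of_le_half h0 h⟩
  · exact exists_isPosDefFun_of_half_lt h h1

/-! ### The kernel `R_θ` -/

lemma Matrix.PosSemidef.map_re {X : Type*} {A : Matrix X X ℂ} (hA : A.PosSemidef) :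
    (A.map Complex.re).PosSemidef := by
  refine ⟨?_, fun x => ?_⟩
  · ext i j
    have := congrArg Complex.re (congrFun (congrFun hA.1 i) j)
    simpa using this
  · have h := hA.2 (x.mapRange (fun r : ℝ => (r : ℂ)) Complex.ofReal_zero)
    have h' := (Complex.le_def.1 h).1
    rw [Finsupp.sum_mapRange_index (by simp)] at h'
    simp_rw [Finsupp.sum_mapRange_index (h := fun j xj => star _ * A _ j * xj) (by simp)] at h'
    simpa [Finsupp.sum, Complex.mul_re, Complex.re_sum] using h'

lemma covG_neg (H v : ℝ) : covG H (-v) = -covG H v := by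
  simp [covG, covF_neg]

lemma covR_eq (H₁ H₂ θ : ℝ) (v : ℝ × ℝ) : covR H₁ H₂ θ v =
    1 / 4 * (covF H₁ v.1 * covF H₂ v.2 + θ * (covG H₁ v.1 * covG H₂ v.2)) := by
  rw [covR, covG, covG, sub_eq_add_neg, Real.exp_add, neg_mul, neg_mul]
  ring

theorem mainTheorem1 (H₁ H₂ : ℝ) (hH₁ : 0 < H₁ ∧ H₁ < 1) (hH₂ : 0 < H₂ ∧ H₂ < 1) :
    (∀ (θ : ℝ) (v : ℝ × ℝ), covR H₁ H₂ θ v = covR H₁ H₂ θ (-v)) ∧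
    (∀ θ : ℝ, θ ≠ 0 → covR H₁ H₂ θ ≠ covR0 H₁ H₂) ∧
    (∀ (θ : ℝ) (v : ℝ × ℝ),
      covR H₁ H₂ θ v + covR H₁ H₂ θ (v.1, -v.2) = 2 * covR0 H₁ H₂ v ∧
      covR H₁ H₂ θ v + covR H₁ H₂ θ (-v.1, v.2) = 2 * covR0 H₁ H₂ v) ∧
    (∃ θ : ℝ, θ ≠ 0 ∧ IsPositiveDefiniteKernel (fun u v : ℝ × ℝ => covR H₁ H₂ θ (u - v))) := by
  refine ⟨fun θ v => ?_, fun θ hθ h => ?_, fun θ v => ⟨?_, ?_⟩, ?_⟩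
  · simp [covR_eq, covF_neg, covG_neg]
  · have h1 := congrFun h (1, 1)
    have hG : ∀ {H : ℝ}, 0 < H → 0 < covG H 1 := fun {H} hH =>
      mul_pos (covF_pos hH 1) (mul_pos (Real.exp_pos _) (Real.sinh_pos_iff.2 (by simpa using hH)))
    have h2 := mul_pos (hG hH₁.1) (hG hH₂.1)
    have h3 : θ * (covG H₁ 1 * covG H₂ 1) = 0 := by
      simp only [covR_eq, covR0] at h1
      linarith
    exact (mul_ne_zero hθ h2.ne') h3
  · simp only [covR_eq, covR0, covF_neg, covG_neg]; ring
  · simp only [covR_eq, covR0, covF_neg, covG_neg]; ring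
  · obtain ⟨C₁, hC₁, h₁⟩ := exists_isPosDefFun_covF_add_covG hH₁.1 hH₁.2
    obtain ⟨C₂, hC₂, h₂⟩ := exists_isPosDefFun_covF_add_covG hH₂.1 hH₂.2
    refine ⟨1 / (C₁ * C₂), by positivity, ?_⟩
    -- The transpose of the second kernel replaces `G` by `-G`; the real part of the product with
    -- the first one is then `C₁ C₂ F₁ F₂ + G₁ G₂`.
    have hprod := (Matrix.PosSemidef.submatrix h₁ (Prod.fst : ℝ × ℝ → ℝ)).hadamard
      ((Matrix.PosSemidef.transpose h₂).submatrix (Prod.snd : ℝ × ℝ → ℝ))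
    have hre := Matrix.PosSemidef.smul (α := ℝ) hprod.map_re
      (a := 1 / (4 * (C₁ * C₂))) (by positivity)
    refine (congrArg Matrix.PosSemidef ?_).mp hre
    ext u v
    have hs : v.2 - u.2 = -(u.2 - v.2) := by ring
    simp only [Matrix.smul_apply, Matrix.map_apply, Matrix.hadamard_apply, Matrix.submatrix_apply,
      Matrix.transpose_apply, Matrix.of_apply, covR_eq, Prod.fst_sub, Prod.snd_sub, hs, covF_neg,
      covG_neg, smul_eq_mul]
    simp
    field_simp
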